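/- For a positive integer $r$ let $$n_r=\frac{1}{r^{2}}\sum_{d\mid r}\mu\!\left(\frac rd\right)\binom{3d-1}{d-1},$$ where the sum is over the positive divisors $d$ of $r$ and $\mu$ is the Möbius function. Let $\mathcal W$ be the set of odd positive integers whose binary expansion has no two consecutive $1$'s. Then for every positive integer $r$: (a) $\dfrac{2n_r}{r}$ is an integer; (b) $\dfrac{n_r}{r}$ is an integer if and only if either $r$ is odd, or $r=2^k r_1$ with $k>0$ and $r_1$ odd, and the set of $w\in\mathcal W$ such that $w\mid r_1$ and $r_1/w$ is squarefree has even cardinality. -/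

import Mathlib

/-- `n_r = r⁻² ∑_{d ∣ r} μ(r/d) * binom(3d-1, d-1)`, as a rational number (for `r ≥ 1`). -/
def bpsN (r : ℕ) : ℚ :=
  (∑ d ∈ r.divisors,
    (ArithmeticFunction.moebius (r / d) : ℚ) * (Nat.choose (3 * d - 1) (d - 1) : ℚ)) / (r : ℚ) ^ 2

/-- A natural number is well-spaced if its binary expansion has no two consecutive ones. -/
def WellSpaced (m : ℕ) : Prop :=
  ∀ j : ℕ, ¬ (m.testBit j = true ∧ m.testBit (j + 1) = true)

/-- The set of odd well-spaced natural numbers. -/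
def oddWellSpaced : Set ℕ :=
  {w | Odd w ∧ WellSpaced w}

/-- The rational number `q` is an integer. -/
def IsInteger (q : ℚ) : Prop :=
  ∃ m : ℤ, q = (m : ℚ)

/-! Let S(r) be the Möbius sum, so n_r/r = S(r)/r³, and put f(d) = C(3d-1, d-1). If r = p^k m with k
> 0 and p ∤ m, then S(r) collapses to ∑_{d∣m} μ(m/d)(f(p^k d) - f(p^(k-1) d)), so everything rests
on p-adic congruences between consecutive binomials. With n = p^k d, their ratio is ∏ (2n+i)/i over
i < n prime to p. Pairing i with n-i shows that its square is 1 - 6n² ∑ i⁻² modulo the p-part of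
6n³. For odd p, 3∑ i⁻² vanishes mod p^k, so p^(3k) divides the difference
(`pow_dvd_choose_sub_choose`). For p = 2 and d odd, ∑ i⁻² is exactly divisible by 2^(k-1), so the
difference is 2^(3k-1) times a number with the parity of f(2^(k-1) d)
(`exists_choose_sub_choose_eq`). By Lucas this parity detects well-spaced d. Hence only one factor 2
can be missing from S(r)/r³, and it is missing exactly when the count in (b) is odd. -/

/-- The numbers below `n` that are not divisible by `p`. -/
def rangeNotDvd (p n : ℕ) : Finset ℕ := {i ∈ Finset.range n | ¬ p ∣ i}

theorem mem_rangeNotDvd {p n i : ℕ} : i ∈ rangeNotDvd p n ↔ i < n ∧ ¬ p ∣ i := by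
  simp [rangeNotDvd]

theorem prod_rangeNotDvd_reflect {M : Type*} [CommMonoid M] {p n : ℕ} (hpn : p ∣ n) (f : ℕ → M) :
    ∏ i ∈ rangeNotDvd p n, f (n - i) = ∏ i ∈ rangeNotDvd p n, f i := by
  have key : ∀ i ∈ rangeNotDvd p n, n - i ∈ rangeNotDvd p n := by
    intro i hi
    rw [mem_rangeNotDvd] at hi ⊢
    have hi0 : i ≠ 0 := by rintro rfl; exact hi.2 (dvd_zero p)
    refine ⟨by lia, fun h => hi.2 ?_⟩
    exact (Nat.dvd_sub_iff_right hi.1.le hpn).1 h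
  refine Finset.prod_nbij' (fun i => n - i) (fun i => n - i) key key ?_ ?_ ?_
  · intro i hi; have := (mem_rangeNotDvd.1 hi).1; lia
  · intro i hi; have := (mem_rangeNotDvd.1 hi).1; lia
  · intro i hi; rfl

/-- Isolates the multiples of `p`, which reproduce the product for `a` and cancel in the ratio of
binomials. -/
theorem prod_Ioc_mul_split {M : Type*} [CommMonoid M] {p : ℕ} (hp : 0 < p) (a : ℕ) (f : ℕ → M) :
    ∏ i ∈ Finset.Ioc 0 (p * a), f i
      = (∏ i ∈ rangeNotDvd p (p * a), f i) * ∏ j ∈ Finset.Ioc 0 a, f (p * j) := by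
  rw [← Finset.prod_filter_not_mul_prod_filter (Finset.Ioc 0 (p * a)) (fun i => p ∣ i)]
  congr 1
  · refine Finset.prod_congr ?_ fun _ _ => rfl
    ext i
    simp only [Finset.mem_filter, Finset.mem_Ioc, mem_rangeNotDvd]
    constructor
    · rintro ⟨⟨h0, h1⟩, h2⟩
      refine ⟨lt_of_le_of_ne h1 ?_, h2⟩
      rintro rfl
      exact h2 (dvd_mul_right _ _)
    · rintro ⟨h1, h2⟩
      refine ⟨⟨Nat.pos_of_ne_zero ?_, h1.le⟩, h2⟩
      rintro rfl
      exact h2 (dvd_zero _)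
  · symm
    refine Finset.prod_nbij (fun j => p * j) ?_ ?_ ?_ fun _ _ => rfl
    · intro j hj
      simp only [Finset.mem_filter, Finset.mem_Ioc] at hj ⊢
      exact ⟨⟨Nat.mul_pos hp hj.1, Nat.mul_le_mul_left p hj.2⟩, dvd_mul_right _ _⟩
    · intro x _ y _ h
      exact Nat.eq_of_mul_eq_mul_left hp h
    · intro i hi
      simp only [Finset.coe_filter, Finset.mem_Ioc, Set.mem_ofPred_eq] at hi
      obtain ⟨⟨h0, h1⟩, j, rfl⟩ := hi
      refine ⟨j, ?_, rfl⟩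
      simp only [Finset.coe_Ioc, Set.mem_Ioc]
      exact ⟨Nat.pos_of_mul_pos_left h0, Nat.le_of_mul_le_mul_left h1 hp⟩

theorem choose_three_mul_mul_prod (n : ℕ) :
    (3 * n).choose n * ∏ i ∈ Finset.Ioc 0 n, i = ∏ i ∈ Finset.Ioc 0 n, (2 * n + i) := by
  have h1 : ∀ m, ∏ i ∈ Finset.Ioc 0 m, i = m.factorial := by
    intro m
    induction m with
    | zero => simp
    | succ m ih => rw [Finset.prod_Ioc_succ_top (by lia), ih, Nat.factorial_succ, mul_comm]
  have h2 : ∀ b m, ∏ i ∈ Finset.Ioc 0 m, (b + i) = (b + 1).ascFactorial m := by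
    intro b m
    induction m with
    | zero => simp
    | succ m ih =>
      rw [Finset.prod_Ioc_succ_top (by lia), ih, Nat.ascFactorial_succ, mul_comm]
      congr 1; ring
  rw [h1, h2, Nat.ascFactorial_eq_factorial_mul_choose, mul_comm]
  congr 2; ring

theorem three_mul_choose_pred {n : ℕ} (hn : 0 < n) :
    3 * (3 * n - 1).choose (n - 1) = (3 * n).choose n := by
  obtain ⟨m, rfl⟩ : ∃ m, n = m + 1 := ⟨n - 1, by lia⟩
  have h := Nat.add_one_mul_choose_eq (3 * m + 2) m
  have h3 : 3 * (m + 1) - 1 = 3 * m + 2 := by lia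
  have h4 : 3 * (m + 1) = 3 * m + 2 + 1 := by lia
  rw [h3, Nat.add_sub_cancel, h4]
  apply Nat.eq_of_mul_eq_mul_right (Nat.succ_pos m)
  rw [Nat.succ_eq_add_one, ← h]; ring

/-- The passage from `a` to `p * a` multiplies `choose (3 * a - 1) (a - 1)` by
`∏ (2 * p * a + i) / i`, the product being over the `i < p * a` not divisible by `p`. -/
theorem choose_mul_prod_rangeNotDvd {p a : ℕ} (hp : 0 < p) (ha : 0 < a) :
    (3 * (p * a) - 1).choose (p * a - 1) * ∏ i ∈ rangeNotDvd p (p * a), i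
      = (3 * a - 1).choose (a - 1) * ∏ i ∈ rangeNotDvd p (p * a), (2 * (p * a) + i) := by
  have h := choose_three_mul_mul_prod (p * a)
  have h' := choose_three_mul_mul_prod a
  rw [← three_mul_choose_pred (Nat.mul_pos hp ha), prod_Ioc_mul_split hp a (fun i => i),
    prod_Ioc_mul_split hp a (fun i => 2 * (p * a) + i)] at h
  rw [← three_mul_choose_pred ha] at h'
  have e : ∏ j ∈ Finset.Ioc 0 a, (2 * (p * a) + p * j)
      = (∏ j ∈ Finset.Ioc 0 a, p) * ∏ j ∈ Finset.Ioc 0 a, (2 * a + j) := by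
    rw [← Finset.prod_mul_distrib]
    exact Finset.prod_congr rfl fun j _ => by ring
  rw [e, ← h', Finset.prod_mul_distrib] at h
  have hpos : 0 < 3 * ((∏ j ∈ Finset.Ioc 0 a, p) * ∏ j ∈ Finset.Ioc 0 a, j) := by
    have : 0 < ∏ j ∈ Finset.Ioc 0 a, j := Finset.prod_pos fun j hj => (Finset.mem_Ioc.1 hj).1
    have : 0 < ∏ j ∈ Finset.Ioc 0 a, p := Finset.prod_pos fun j _ => hp
    positivity
  apply Nat.eq_of_mul_eq_mul_right hpos
  linear_combination h

/-! ### The squared ratio modulo a prime power -/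

theorem prod_one_sub_mul_of_sq_eq_zero {R ι : Type*} [CommRing R] {t : R} (ht : t * t = 0)
    (s : Finset ι) (f : ι → R) : ∏ i ∈ s, (1 - t * f i) = 1 - t * ∑ i ∈ s, f i := by
  classical
  induction s using Finset.induction_on with
  | empty => simp
  | insert a s ha ih =>
    rw [Finset.prod_insert ha, Finset.sum_insert ha, ih]
    linear_combination (f a * ∑ i ∈ s, f i) * ht

/-- Pairing `i` with `n - i` computes the square of `∏ (2 * n + i)` modulo `p ^ s`. -/
theorem sq_prod_rangeNotDvd {p n s : ℕ} (hp : p.Prime) (hpn : p ∣ n) (hs : p ^ s ∣ 6 * n ^ 3) :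
    ((∏ i ∈ rangeNotDvd p n, (2 * n + i) : ℕ) : ZMod (p ^ s)) ^ 2
      = ((∏ i ∈ rangeNotDvd p n, i : ℕ) : ZMod (p ^ s)) ^ 2
        * (1 - 6 * (n : ZMod (p ^ s)) ^ 2
            * ((∑ i ∈ rangeNotDvd p n, i ^ (2 * (Nat.totient (p ^ s) - 1)) : ℕ) : ZMod (p ^ s))) := by
  -- By Euler, the exponent 2(φ - 1) represents i⁻² for i prime to `p`.
  set φ := Nat.totient (p ^ s) with hφ
  have hφ0 : 0 < φ := Nat.totient_pos.2 (pow_pos hp.pos s)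
  obtain ⟨e, he⟩ : ∃ e, φ = e + 1 := ⟨φ - 1, by lia⟩
  have hn3 : 6 * (n : ZMod (p ^ s)) ^ 3 = 0 := by
    have := (ZMod.natCast_eq_zero_iff (6 * n ^ 3) (p ^ s)).2 hs
    exact_mod_cast this
  have ht : (6 * (n : ZMod (p ^ s)) ^ 2) * (6 * (n : ZMod (p ^ s)) ^ 2) = 0 := by
    linear_combination (6 * (n : ZMod (p ^ s))) * hn3
  have hpow : ∀ i ∈ rangeNotDvd p n, (i : ZMod (p ^ s)) ^ (e + 1) = 1 := by
    intro i hi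
    have hc : Nat.Coprime i (p ^ s) :=
      (((Nat.Prime.coprime_iff_not_dvd hp).2 (mem_rangeNotDvd.1 hi).2).pow_left s).symm
    have := Nat.ModEq.pow_totient hc
    rw [← ZMod.natCast_eq_natCast_iff, ← hφ, he] at this
    exact_mod_cast this
  have hsub : ∀ i ∈ rangeNotDvd p n, ((n - i : ℕ) : ZMod (p ^ s)) = n - i := fun i hi =>
    Nat.cast_sub (mem_rangeNotDvd.1 hi).1.le
  push_cast
  rw [← prod_one_sub_mul_of_sq_eq_zero ht, sq, sq]
  -- Reversing one copy of each product leaves a factorwise claim: (2n+i)(3n-i) = i(n-i) + 6n²,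
  -- which is i(n-i)(1 - 6n² i⁻²) once 6n³ = 0.
  nth_rewrite 2 [← prod_rangeNotDvd_reflect hpn]
  nth_rewrite 4 [← prod_rangeNotDvd_reflect hpn]
  rw [← Finset.prod_mul_distrib, ← Finset.prod_mul_distrib, ← Finset.prod_mul_distrib]
  refine Finset.prod_congr rfl fun i hi => ?_
  have h1 := hpow i hi
  have h2 : (i : ZMod (p ^ s)) ^ (2 * e) * i ^ 2 = 1 := by
    calc (i : ZMod (p ^ s)) ^ (2 * e) * i ^ 2 = (i ^ (e + 1)) ^ 2 := by ring
      _ = 1 := by rw [h1, one_pow]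
  rw [hsub i hi, he, Nat.add_sub_cancel]
  linear_combination (-6 * (n : ZMod (p ^ s)) ^ 2) * h2 + (i : ZMod (p ^ s)) ^ (2 * e) * i * hn3

/-! ### Sums of inverse squares -/

theorem sum_range_mul_of_periodic {M : Type*} [AddCommMonoid M] {q : ℕ} {f : ℕ → M}
    (hf : ∀ i, f (i + q) = f i) (a : ℕ) :
    ∑ i ∈ Finset.range (q * a), f i = a • ∑ i ∈ Finset.range q, f i := by
  have hf' : ∀ b i, f (q * b + i) = f i := by
    intro b i
    induction b with
    | zero => simp
    | succ b ih => rw [← ih, ← hf (q * b + i)]; congr 1; ring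
  induction a with
  | zero => simp
  | succ a ih =>
    rw [Nat.mul_succ, Finset.sum_range_add, ih, succ_nsmul]
    simp only [hf']

theorem sum_range_two_mul_of_periodic {M : Type*} [AddCommMonoid M] {q : ℕ} (hq : Odd q)
    {f : ℕ → M} (hf : ∀ i, f (i + q) = f i) :
    ∑ i ∈ Finset.range q, f (2 * i) = ∑ i ∈ Finset.range q, f i := by
  have hper : Function.Periodic f q := hf
  have hq0 : 0 < q := hq.pos
  have hmaps : ∀ i ∈ Finset.range q, 2 * i % q ∈ Finset.range q := fun i _ =>
    Finset.mem_range.2 (Nat.mod_lt _ hq0)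
  have hinj : Set.InjOn (fun i => 2 * i % q) (Finset.range q : Set ℕ) := by
    intro i hi j hj h
    rw [Finset.mem_coe, Finset.mem_range] at hi hj
    have h2 : 2 * i ≡ 2 * j [MOD q] := h
    have hg : Nat.gcd q 2 = 1 := hq.coprime_two_right
    have h3 := Nat.ModEq.cancel_left_of_coprime hg h2
    exact h3.eq_of_lt_of_lt hi hj
  refine Finset.sum_nbij (fun i => 2 * i % q) hmaps hinj
    (Finset.surjOn_of_injOn_of_card_le _ hmaps hinj le_rfl) ?_
  intro i _
  exact (hper.map_mod_nat (2 * i)).symm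

/-- For odd `p`, multiplication by `2` permutes the units modulo `p ^ k`. -/
theorem pow_dvd_three_mul_sum_rangeNotDvd {p k s : ℕ} (hp : p.Prime) (hodd : Odd p) (hk : 0 < k)
    (hks : k ≤ s) (a : ℕ) :
    p ^ k ∣ 3 * ∑ i ∈ rangeNotDvd p (p ^ k * a), i ^ (2 * (Nat.totient (p ^ s) - 1)) := by
  set φ := Nat.totient (p ^ s) with hφ
  have hφ0 : 0 < φ := Nat.totient_pos.2 (pow_pos hp.pos s)
  obtain ⟨e, he⟩ : ∃ e, φ = e + 1 := ⟨φ - 1, by lia⟩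
  rw [he, Nat.add_sub_cancel, ← ZMod.natCast_eq_zero_iff, rangeNotDvd, Finset.sum_filter]
  push_cast
  set f : ℕ → ZMod (p ^ k) := fun i => if ¬ p ∣ i then (i : ZMod (p ^ k)) ^ (2 * e) else 0 with hf
  have hper : ∀ i, f (i + p ^ k) = f i := by
    intro i
    have h1 : p ∣ i + p ^ k ↔ p ∣ i := Nat.dvd_add_left (dvd_pow_self p hk.ne')
    have h2 : ((i + p ^ k : ℕ) : ZMod (p ^ k)) = i := by
      rw [Nat.cast_add, ZMod.natCast_self, add_zero]
    simp only [hf, h1, h2]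
  have h2pow : (2 : ZMod (p ^ k)) ^ (e + 1) = 1 := by
    have hc : Nat.Coprime 2 (p ^ s) := (Nat.coprime_two_left.2 hodd).pow_right s
    have h := (Nat.ModEq.pow_totient hc).of_dvd (pow_dvd_pow p hks)
    rw [← ZMod.natCast_eq_natCast_iff, ← hφ, he] at h
    exact_mod_cast h
  have hmul : ∀ i, 4 * f (2 * i) = f i := by
    intro i
    have h1 : p ∣ 2 * i ↔ p ∣ i :=
      Nat.Coprime.dvd_mul_left (Nat.coprime_two_right.2 hodd)
    simp only [hf, h1]
    split_ifs with h
    · simp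
    · push_cast
      have : (4 : ZMod (p ^ k)) * 2 ^ (2 * e) = 1 := by
        calc (4 : ZMod (p ^ k)) * 2 ^ (2 * e) = (2 ^ (e + 1)) ^ 2 := by ring
          _ = 1 := by rw [h2pow, one_pow]
      rw [mul_pow, ← mul_assoc, this, one_mul]
  -- Since f(2i) = f(i)/4, permuting by 2 gives 4∑f = ∑f. The 3 is kept because `p` may be 3; the
  -- coefficient 6n² later supplies it.
  have hsum : (3 : ZMod (p ^ k)) * ∑ i ∈ Finset.range (p ^ k), f i = 0 := by
    have h := sum_range_two_mul_of_periodic (hodd.pow (n := k)) hper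
    have h' : 4 * ∑ i ∈ Finset.range (p ^ k), f (2 * i) = ∑ i ∈ Finset.range (p ^ k), f i := by
      rw [Finset.mul_sum]; exact Finset.sum_congr rfl fun i _ => hmul i
    linear_combination h' - 4 * h
  have := sum_range_mul_of_periodic hper a
  have hcast : ∀ i, ((if ¬ p ∣ i then i ^ (2 * e) else 0 : ℕ) : ZMod (p ^ k)) = f i := by
    intro i; simp only [hf]; split_ifs <;> simp
  simp only [← hcast] at this hsum
  push_cast at this hsum
  rw [this, nsmul_eq_mul]
  linear_combination (a : ZMod (p ^ k)) * hsum

/-- The numbers i and 2n + i have equal squares modulo 4n, so the two halves of the range agree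
there. -/
theorem sum_rangeNotDvd_two_mul (n e : ℕ) :
    ∃ c, ∑ i ∈ rangeNotDvd 2 (2 * (2 * n)), i ^ (2 * e)
      = 2 * (∑ i ∈ rangeNotDvd 2 (2 * n), i ^ (2 * e)) + 4 * n * c := by
  have hsq : ∀ i, ∃ c, (2 * n + i) ^ (2 * e) = i ^ (2 * e) + 4 * n * c := by
    intro i
    have h : i ^ 2 ≡ (2 * n + i) ^ 2 [MOD 4 * n] := by
      refine (Nat.modEq_iff_dvd' (Nat.pow_le_pow_left (by lia) 2)).2 ⟨n + i, ?_⟩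
      have : (2 * n + i) ^ 2 = i ^ 2 + 4 * n * (n + i) := by ring
      lia
    have h' := h.pow e
    rw [← pow_mul, ← pow_mul] at h'
    have hle : i ^ (2 * e) ≤ (2 * n + i) ^ (2 * e) := Nat.pow_le_pow_left (by lia) _
    obtain ⟨c, hc⟩ := (Nat.modEq_iff_dvd' hle).1 h'
    exact ⟨c, by lia⟩
  choose c hc using hsq
  have hdvd : ∀ i, 2 ∣ 2 * n + i ↔ 2 ∣ i := fun i => by lia
  refine ⟨∑ i ∈ rangeNotDvd 2 (2 * n), c i, ?_⟩
  simp only [rangeNotDvd, Finset.sum_filter]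
  rw [two_mul (2 * n), Finset.sum_range_add]
  simp only [hdvd, hc]
  rw [Finset.mul_sum, Finset.mul_sum, ← Finset.sum_add_distrib, ← Finset.sum_add_distrib]
  refine Finset.sum_congr rfl fun i _ => ?_
  split_ifs <;> ring

theorem odd_sum_rangeNotDvd_two {a : ℕ} (ha : Odd a) (e : ℕ) :
    Odd (∑ i ∈ rangeNotDvd 2 (2 * a), i ^ e) := by
  have h : ∀ b, (Odd (∑ i ∈ rangeNotDvd 2 (2 * b), i ^ e) ↔ Odd b) := by
    intro b
    simp only [rangeNotDvd, Finset.sum_filter]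
    induction b with
    | zero => simp
    | succ b ih =>
      have h1 : ¬ 2 ∣ 2 * b + 1 := by lia
      have h2 : Odd ((2 * b + 1) ^ e) := Odd.pow ⟨b, rfl⟩
      rw [Nat.mul_succ, Finset.sum_range_succ, Finset.sum_range_succ]
      simp only [dvd_mul_right, not_true_eq_false, if_false, h1, not_false_eq_true, if_true,
        add_zero]
      rw [Nat.odd_add, ih, Nat.odd_add]
      simp [Nat.not_even_iff_odd.2 h2]
  exact (h a).2 ha

theorem exists_sum_rangeNotDvd_two_eq {a : ℕ} (ha : Odd a) (e k : ℕ) :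
    ∃ c, Odd c ∧ ∑ i ∈ rangeNotDvd 2 (2 ^ (k + 1) * a), i ^ (2 * e) = 2 ^ k * c := by
  induction k with
  | zero => exact ⟨_, by simpa using odd_sum_rangeNotDvd_two ha (2 * e), by simp⟩
  | succ k ih =>
    obtain ⟨c, hc, h⟩ := ih
    obtain ⟨d, hd⟩ := sum_rangeNotDvd_two_mul (2 ^ k * a) e
    have e1 : 2 * (2 ^ k * a) = 2 ^ (k + 1) * a := by ring
    have e2 : 2 * (2 ^ (k + 1) * a) = 2 ^ (k + 1 + 1) * a := by ring
    rw [e1, e2, h] at hd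
    -- The error 4·2^k·a·d has one factor 2 more than the main term 2^(k+1)·c.
    exact ⟨c + 2 * (a * d), hc.add_even (even_two_mul _), by rw [hd]; ring⟩

/-! ### From the square to the ratio itself -/

theorem not_dvd_prod_rangeNotDvd {p : ℕ} (hp : p.Prime) (n : ℕ) :
    ¬ p ∣ ∏ i ∈ rangeNotDvd p n, i := by
  rw [hp.prime.dvd_finsetProd_iff]
  rintro ⟨i, hi, h⟩
  exact (mem_rangeNotDvd.1 hi).2 h

theorem dvd_prod_rangeNotDvd_sub (p n : ℕ) :
    (2 * n : ℤ) ∣ ((∏ i ∈ rangeNotDvd p n, (2 * n + i) : ℕ) : ℤ)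
      - ((∏ i ∈ rangeNotDvd p n, i : ℕ) : ℤ) := by
  rw [← Int.modEq_iff_dvd]
  push_cast
  refine Int.ModEq.prod fun i _ => ?_
  rw [Int.modEq_iff_dvd]
  exact ⟨1, by ring⟩

theorem dvd_sq_prod_rangeNotDvd {p n s : ℕ} (hp : p.Prime) (hpn : p ∣ n)
    (hs : p ^ s ∣ 6 * n ^ 3) :
    ((p : ℤ) ^ s) ∣ ((∏ i ∈ rangeNotDvd p n, (2 * n + i) : ℕ) : ℤ) ^ 2
      - ((∏ i ∈ rangeNotDvd p n, i : ℕ) : ℤ) ^ 2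
        * (1 - 6 * (n : ℤ) ^ 2
            * ((∑ i ∈ rangeNotDvd p n, i ^ (2 * (Nat.totient (p ^ s) - 1)) : ℕ) : ℤ)) := by
  have h := sq_prod_rangeNotDvd hp hpn hs
  have h2 := (ZMod.intCast_zmod_eq_zero_iff_dvd (((∏ i ∈ rangeNotDvd p n, (2 * n + i) : ℕ) : ℤ) ^ 2
      - ((∏ i ∈ rangeNotDvd p n, i : ℕ) : ℤ) ^ 2
        * (1 - 6 * (n : ℤ) ^ 2
            * ((∑ i ∈ rangeNotDvd p n, i ^ (2 * (Nat.totient (p ^ s) - 1)) : ℕ) : ℤ))) (p ^ s)).1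
  rw [Nat.cast_pow] at h2
  apply h2
  rw [Int.cast_sub, Int.cast_pow, Int.cast_mul, Int.cast_pow, Int.cast_sub, Int.cast_mul,
    Int.cast_mul, Int.cast_pow, Int.cast_natCast, Int.cast_natCast, Int.cast_natCast,
    Int.cast_natCast, h]
  simp

/-- Factor Q² - P² = (Q + P)(Q - P): as Q ≡ P mod p, the first factor is ≡ 2P, a unit for odd `p`.
-/
theorem pow_dvd_prod_rangeNotDvd_sub {p k : ℕ} (hp : p.Prime) (hodd : Odd p) (hk : 0 < k) (a : ℕ) :
    (p : ℤ) ^ (3 * k) ∣ ((∏ i ∈ rangeNotDvd p (p ^ k * a), (2 * (p ^ k * a) + i) : ℕ) : ℤ)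
      - ((∏ i ∈ rangeNotDvd p (p ^ k * a), i : ℕ) : ℤ) := by
  have hpn : p ∣ p ^ k * a := (dvd_pow_self p hk.ne').mul_right a
  have h := dvd_sq_prod_rangeNotDvd (s := 3 * k) hp hpn ⟨6 * a ^ 3, by ring⟩
  obtain ⟨c, hc⟩ := pow_dvd_three_mul_sum_rangeNotDvd (s := 3 * k) hp hodd hk (by lia) a
  have hd := dvd_prod_rangeNotDvd_sub p (p ^ k * a)
  have hP := not_dvd_prod_rangeNotDvd hp (p ^ k * a)
  set Q := ∏ i ∈ rangeNotDvd p (p ^ k * a), (2 * (p ^ k * a) + i)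
  set P := ∏ i ∈ rangeNotDvd p (p ^ k * a), i
  set E := ∑ i ∈ rangeNotDvd p (p ^ k * a), i ^ (2 * (Nat.totient (p ^ (3 * k)) - 1))
  have hcz : 3 * (E : ℤ) = (p : ℤ) ^ k * c := by exact_mod_cast hc
  have hsq : (p : ℤ) ^ (3 * k) ∣ ((Q : ℤ) + P) * (Q - P) := by
    obtain ⟨x, hx⟩ := h
    refine ⟨x - 2 * P ^ 2 * a ^ 2 * c, ?_⟩
    push_cast at hx
    linear_combination hx - 2 * P ^ 2 * ((p : ℤ) ^ k * a) ^ 2 * hcz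
  have hpz : Prime (p : ℤ) := Nat.prime_iff_prime_int.1 hp
  have hpd : (p : ℤ) ∣ (Q : ℤ) - P := by
    refine dvd_trans ?_ hd
    exact Dvd.dvd.mul_left (by exact_mod_cast hpn) 2
  refine IsCoprime.dvd_of_dvd_mul_left (IsCoprime.pow_left ?_) hsq
  refine (Prime.coprime_iff_not_dvd hpz).2 fun hcon => ?_
  have h2P : (p : ℤ) ∣ 2 * P := by
    have := dvd_sub hcon hpd
    rwa [show (Q : ℤ) + P - (Q - P) = 2 * P by ring] at this
  rcases hpz.dvd_or_dvd h2P with h2 | h2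
  · have : p ∣ 2 := by exact_mod_cast h2
    rw [(Nat.prime_dvd_prime_iff_eq hp Nat.prime_two).1 this] at hodd
    exact absurd hodd (by decide)
  · exact hP (by exact_mod_cast h2)

theorem exists_prod_rangeNotDvd_two_sub_eq {a : ℕ} (ha : Odd a) (k : ℕ) :
    ∃ c : ℤ, Odd c ∧
      ((∏ i ∈ rangeNotDvd 2 (2 ^ (k + 1) * a), (2 * (2 ^ (k + 1) * a) + i) : ℕ) : ℤ)
        - ((∏ i ∈ rangeNotDvd 2 (2 ^ (k + 1) * a), i : ℕ) : ℤ) = 2 ^ (3 * k + 2) * c := by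
  have hpn : 2 ∣ 2 ^ (k + 1) * a := (dvd_pow_self 2 k.succ_ne_zero).mul_right a
  -- The exponent 3k+4 is the power of 2 in 6n³, one more than the 3k+3 in 6n²∑i⁻², so the latter
  -- term fixes the exact valuation.
  have h := dvd_sq_prod_rangeNotDvd (s := 3 * k + 4) Nat.prime_two hpn ⟨3 * a ^ 3, by ring⟩
  obtain ⟨c, hcodd, hc⟩ :=
    exists_sum_rangeNotDvd_two_eq ha (Nat.totient (2 ^ (3 * k + 4)) - 1) k
  have hd := dvd_prod_rangeNotDvd_sub 2 (2 ^ (k + 1) * a)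
  have hP := not_dvd_prod_rangeNotDvd Nat.prime_two (2 ^ (k + 1) * a)
  rw [hc] at h
  set Q := ∏ i ∈ rangeNotDvd 2 (2 ^ (k + 1) * a), (2 * (2 ^ (k + 1) * a) + i)
  set P := ∏ i ∈ rangeNotDvd 2 (2 ^ (k + 1) * a), i
  have hPodd : Odd (P : ℤ) := by
    rw [Int.odd_coe_nat, ← Nat.not_even_iff_odd, even_iff_two_dvd]; exact hP
  obtain ⟨x, hx⟩ := h
  obtain ⟨y, hy⟩ := hd
  -- `Q + P = 2 * u` with `u` odd, so `u * (Q - P)` is an odd multiple of `2 ^ (3 * k + 2)`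
  set u : ℤ := P + 2 * (2 ^ k * a * y) with hu
  have huodd : Odd u := hPodd.add_even (even_two_mul _)
  have hsum : (Q : ℤ) + P = 2 * u := by
    push_cast at hy
    rw [hu]
    linear_combination hy
  have hz : u * ((Q : ℤ) - P) = 2 ^ (3 * k + 2) * (2 * x - 3 * (P ^ 2 * a ^ 2 * c)) := by
    push_cast at hx
    have h2 : (2 : ℤ) * (u * ((Q : ℤ) - P))
        = 2 * (2 ^ (3 * k + 2) * (2 * x - 3 * (P ^ 2 * a ^ 2 * c))) := by
      linear_combination hx - ((Q : ℤ) - P) * hsum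
    exact mul_left_cancel₀ two_ne_zero h2
  have hcop : IsCoprime ((2 : ℤ) ^ (3 * k + 2)) u :=
    IsCoprime.pow_left (Int.isCoprime_two_left.2 huodd)
  obtain ⟨w, hw⟩ := hcop.dvd_of_dvd_mul_left ⟨_, hz⟩
  refine ⟨w, ?_, hw⟩
  have huw : u * w = 2 * x - 3 * (P ^ 2 * a ^ 2 * c) := by
    have hne : (2 : ℤ) ^ (3 * k + 2) ≠ 0 := by positivity
    apply mul_left_cancel₀ hne
    rw [← hz, hw]; ring
  have hR : Odd (2 * x - 3 * ((P : ℤ) ^ 2 * a ^ 2 * c)) := by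
    refine (even_two_mul x).sub_odd (Odd.mul (by decide) (Odd.mul (Odd.mul hPodd.pow ?_) ?_))
    · exact ((Int.odd_coe_nat a).2 ha).pow
    · exact (Int.odd_coe_nat c).2 hcodd
  rw [← huw] at hR
  exact (Int.odd_mul.1 hR).2

/-! ### Congruences between consecutive binomials -/

theorem pow_dvd_choose_sub_choose {p : ℕ} (hp : p.Prime) (hodd : Odd p) (k : ℕ) {a : ℕ}
    (ha : 0 < a) :
    (p : ℤ) ^ (3 * (k + 1)) ∣
      ((3 * (p ^ (k + 1) * a) - 1).choose (p ^ (k + 1) * a - 1) : ℤ)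
        - ((3 * (p ^ k * a) - 1).choose (p ^ k * a - 1) : ℤ) := by
  have hid := choose_mul_prod_rangeNotDvd hp.pos (Nat.mul_pos (pow_pos hp.pos k) ha)
  rw [show p * (p ^ k * a) = p ^ (k + 1) * a by ring] at hid
  have h := pow_dvd_prod_rangeNotDvd_sub hp hodd k.succ_pos a
  have hP := not_dvd_prod_rangeNotDvd hp (p ^ (k + 1) * a)
  rw [Nat.succ_eq_add_one] at h
  set Q := ∏ i ∈ rangeNotDvd p (p ^ (k + 1) * a), (2 * (p ^ (k + 1) * a) + i)
  set P := ∏ i ∈ rangeNotDvd p (p ^ (k + 1) * a), i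
  have hidz : ((3 * (p ^ (k + 1) * a) - 1).choose (p ^ (k + 1) * a - 1) : ℤ) * P
      = ((3 * (p ^ k * a) - 1).choose (p ^ k * a - 1) : ℤ) * Q := by exact_mod_cast hid
  have hcop : IsCoprime ((p : ℤ) ^ (3 * (k + 1))) P := by
    refine IsCoprime.pow_left ((Prime.coprime_iff_not_dvd (Nat.prime_iff_prime_int.1 hp)).2 ?_)
    exact fun hcon => hP (by exact_mod_cast hcon)
  refine hcop.dvd_of_dvd_mul_right ?_
  rw [sub_mul, hidz, ← mul_sub]
  exact h.mul_left _

theorem exists_choose_sub_choose_eq {a : ℕ} (ha : Odd a) (k : ℕ) :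
    ∃ c : ℤ, (Odd c ↔ Odd ((3 * (2 ^ k * a) - 1).choose (2 ^ k * a - 1))) ∧
      ((3 * (2 ^ (k + 1) * a) - 1).choose (2 ^ (k + 1) * a - 1) : ℤ)
        - ((3 * (2 ^ k * a) - 1).choose (2 ^ k * a - 1) : ℤ) = 2 ^ (3 * k + 2) * c := by
  have hid := choose_mul_prod_rangeNotDvd two_pos (Nat.mul_pos (pow_pos two_pos k) ha.pos)
  rw [show 2 * (2 ^ k * a) = 2 ^ (k + 1) * a by ring] at hid
  obtain ⟨c, hcodd, h⟩ := exists_prod_rangeNotDvd_two_sub_eq ha k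
  have hP := not_dvd_prod_rangeNotDvd Nat.prime_two (2 ^ (k + 1) * a)
  set Q := ∏ i ∈ rangeNotDvd 2 (2 ^ (k + 1) * a), (2 * (2 ^ (k + 1) * a) + i)
  set P := ∏ i ∈ rangeNotDvd 2 (2 ^ (k + 1) * a), i
  set B := (3 * (2 ^ k * a) - 1).choose (2 ^ k * a - 1)
  set A := (3 * (2 ^ (k + 1) * a) - 1).choose (2 ^ (k + 1) * a - 1)
  have hidz : (A : ℤ) * P = (B : ℤ) * Q := by exact_mod_cast hid
  have hPodd : Odd (P : ℤ) := by
    rw [Int.odd_coe_nat, ← Nat.not_even_iff_odd, even_iff_two_dvd]; exact hP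
  have hAB : ((A : ℤ) - B) * P = 2 ^ (3 * k + 2) * (B * c) := by
    linear_combination hidz + (B : ℤ) * h
  have hcop : IsCoprime ((2 : ℤ) ^ (3 * k + 2)) P :=
    IsCoprime.pow_left (Int.isCoprime_two_left.2 hPodd)
  obtain ⟨w, hw⟩ := hcop.dvd_of_dvd_mul_right ⟨_, hAB⟩
  refine ⟨w, ?_, hw⟩
  have hwP : w * P = B * c := by
    have hne : (2 : ℤ) ^ (3 * k + 2) ≠ 0 := by positivity
    apply mul_left_cancel₀ hne
    rw [← hAB, hw]; ring
  have h1 : Odd (w * P) ↔ Odd w := by simp [Int.odd_mul, hPodd]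
  have h2 : Odd ((B : ℤ) * c) ↔ Odd (B : ℤ) := by simp [Int.odd_mul, hcodd]
  rw [← h1, hwP, h2, Int.odd_coe_nat]

/-! ### Parity of the binomials -/

theorem wellSpaced_two_mul {m : ℕ} : WellSpaced (2 * m) ↔ WellSpaced m := by
  constructor
  · intro h j
    have := h (j + 1)
    simpa [Nat.testBit_succ] using this
  · rintro h (_ | j)
    · simp
    · simpa [Nat.testBit_succ] using h j

theorem wellSpaced_two_pow_mul {k m : ℕ} : WellSpaced (2 ^ k * m) ↔ WellSpaced m := by
  induction k with
  | zero => simp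
  | succ k ih => rw [pow_succ', mul_assoc, wellSpaced_two_mul, ih]

theorem wellSpaced_four_mul_add_one {m : ℕ} : WellSpaced (4 * m + 1) ↔ WellSpaced m := by
  have h1 : (4 * m + 1) / 2 = 2 * m := by lia
  constructor
  · intro h j
    have := h (j + 2)
    simpa [Nat.testBit_succ, h1] using this
  · rintro h (_ | _ | j)
    · simp [Nat.testBit_succ, h1]
    · simp [Nat.testBit_succ, h1]
    · simpa [Nat.testBit_succ, h1] using h j

theorem not_wellSpaced_four_mul_add_three (m : ℕ) : ¬ WellSpaced (4 * m + 3) := by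
  intro h
  have h1 : (4 * m + 3) / 2 = 2 * m + 1 := by lia
  have h2 : (4 * m + 3) % 2 = 1 := by lia
  exact h 0 (by simp [Nat.testBit_succ, Nat.testBit_zero, h1, h2])

theorem odd_choose_iff (n k : ℕ) :
    Odd (n.choose k) ↔ Odd ((n % 2).choose (k % 2)) ∧ Odd ((n / 2).choose (k / 2)) := by
  have h := Choose.choose_modEq_choose_mod_mul_choose_div_nat (n := n) (k := k) (p := 2)
  rw [← Nat.odd_mul, Nat.odd_iff, Nat.odd_iff, h]

/-- Lucas modulo 2, recursing on the low bits of d. For d = 4m+3, 3d has second bit 0 below a 1 of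
d, which kills the binomial; the other cases reduce to m. -/
theorem odd_choose_three_mul_iff (d : ℕ) : Odd ((3 * d).choose d) ↔ WellSpaced d := by
  induction d using Nat.strong_induction_on with
  | _ d ih =>
  rcases Nat.eq_zero_or_pos d with rfl | hd
  · simp [WellSpaced]
  obtain ⟨m, rfl | rfl | rfl⟩ : ∃ m, d = 2 * m ∨ d = 4 * m + 1 ∨ d = 4 * m + 3 := by
    rcases Nat.even_or_odd' d with ⟨m, h | h⟩
    · exact ⟨m, Or.inl h⟩
    · exact ⟨m / 2, by lia⟩
  · rw [odd_choose_iff, wellSpaced_two_mul, ← ih m (by lia),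
      show 3 * (2 * m) % 2 = 0 by lia, show 3 * (2 * m) / 2 = 3 * m by lia,
      show 2 * m % 2 = 0 by lia, show 2 * m / 2 = m by lia]
    simp
  · rw [odd_choose_iff, wellSpaced_four_mul_add_one, ← ih m (by lia),
      show 3 * (4 * m + 1) % 2 = 1 by lia, show 3 * (4 * m + 1) / 2 = 6 * m + 1 by lia,
      show (4 * m + 1) % 2 = 1 by lia, show (4 * m + 1) / 2 = 2 * m by lia,
      odd_choose_iff (6 * m + 1),
      show (6 * m + 1) % 2 = 1 by lia, show (6 * m + 1) / 2 = 3 * m by lia,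
      show 2 * m % 2 = 0 by lia, show 2 * m / 2 = m by lia]
    simp
  · rw [odd_choose_iff, show 3 * (4 * m + 3) / 2 = 6 * m + 4 by lia,
      show (4 * m + 3) / 2 = 2 * m + 1 by lia, odd_choose_iff (6 * m + 4),
      show (6 * m + 4) % 2 = 0 by lia, show (2 * m + 1) % 2 = 1 by lia]
    simp [not_wellSpaced_four_mul_add_three]

theorem odd_choose_three_mul_pred_iff {d : ℕ} (hd : 0 < d) :
    Odd ((3 * d - 1).choose (d - 1)) ↔ WellSpaced d := by
  rw [← odd_choose_three_mul_iff, ← three_mul_choose_pred hd, Nat.odd_mul]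
  simp [show Odd 3 by decide]

/-! ### Divisibility of the Möbius sum -/

open ArithmeticFunction in
/-- Only the divisors `p ^ (k + 1) * d` and `p ^ k * d` contribute to a Möbius sum over the
divisors of `p ^ (k + 1) * m`. -/
theorem sum_divisors_moebius_prime_pow_mul {p m : ℕ} (hp : p.Prime) (hpm : ¬ p ∣ m)
    (k : ℕ) (f : ℕ → ℤ) :
    ∑ d ∈ (p ^ (k + 1) * m).divisors, moebius (p ^ (k + 1) * m / d) * f d
      = ∑ d ∈ m.divisors, moebius (m / d) * (f (p ^ (k + 1) * d) - f (p ^ k * d)) := by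
  have hcop : Nat.Coprime p m := (Nat.Prime.coprime_iff_not_dvd hp).2 hpm
  have hterm : ∀ j ≤ k + 1, ∀ d ∈ m.divisors, moebius (p ^ (k + 1) * m / (p ^ j * d))
      = moebius (p ^ (k + 1 - j)) * moebius (m / d) := by
    intro j hj d hd
    have hdm := Nat.dvd_of_mem_divisors hd
    rw [← Nat.div_mul_div_comm (pow_dvd_pow p hj) hdm, Nat.pow_div hj hp.pos]
    exact isMultiplicative_moebius.map_mul_of_coprime
      ((hcop.coprime_dvd_right (Nat.div_dvd_of_dvd hdm)).pow_left _)
  rw [Nat.divisors_mul, Finset.mul_def,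
    Finset.sum_image (hcop.pow_left (k + 1)).mul_injOn_divisors, Finset.sum_product,
    Nat.sum_divisors_prime_pow hp, Finset.sum_range_succ, Finset.sum_range_succ,
    Finset.sum_eq_zero, zero_add, ← Finset.sum_add_distrib]
  · refine Finset.sum_congr rfl fun d hd => ?_
    dsimp only
    rw [hterm k (by lia) d hd, hterm (k + 1) le_rfl d hd, Nat.sub_self, pow_zero,
      moebius_apply_one, show k + 1 - k = 1 by lia, pow_one, moebius_apply_prime hp]
    ring
  · intro j hj
    rw [Finset.mem_range] at hj
    refine Finset.sum_eq_zero fun d hd => ?_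
    dsimp only
    rw [hterm j (by lia) d hd, moebius_apply_prime_pow hp (by lia), if_neg (by lia)]
    ring

/-- The Möbius sum `∑_{d ∣ r} μ(r/d) * binom(3d-1, d-1)`. -/
def moebiusChooseSum (r : ℕ) : ℤ :=
  ∑ d ∈ r.divisors, ArithmeticFunction.moebius (r / d) * ((3 * d - 1).choose (d - 1) : ℤ)

theorem bpsN_eq (r : ℕ) : bpsN r = (moebiusChooseSum r : ℚ) / (r : ℚ) ^ 2 := by
  simp [bpsN, moebiusChooseSum]

theorem isInteger_div_iff {z n : ℤ} (hn : n ≠ 0) : IsInteger ((z : ℚ) / n) ↔ n ∣ z := by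
  have hn' : (n : ℚ) ≠ 0 := Int.cast_ne_zero.2 hn
  constructor
  · rintro ⟨m, hm⟩
    refine ⟨m, ?_⟩
    rw [div_eq_iff hn'] at hm
    rw [mul_comm]
    exact_mod_cast hm
  · rintro ⟨m, rfl⟩
    exact ⟨m, by push_cast; field_simp⟩

theorem pow_dvd_moebiusChooseSum {p m : ℕ} (hp : p.Prime) (hodd : Odd p)
    (hpm : ¬ p ∣ m) (k : ℕ) : (p : ℤ) ^ (3 * k) ∣ moebiusChooseSum (p ^ k * m) := by
  cases k with
  | zero => simp
  | succ k =>
    rw [moebiusChooseSum, sum_divisors_moebius_prime_pow_mul hp hpm k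
      (fun d => ((3 * d - 1).choose (d - 1) : ℤ))]
    refine Finset.dvd_sum fun d hd => Dvd.dvd.mul_left ?_ _
    exact pow_dvd_choose_sub_choose hp hodd k (Nat.pos_of_mem_divisors hd)

theorem odd_cube_dvd_moebiusChooseSum {m r : ℕ} (hm : Odd m) (hr : 0 < r) (hmr : m ∣ r) :
    (m : ℤ) ^ 3 ∣ moebiusChooseSum r := by
  rw [← Int.natCast_pow, Int.natCast_dvd, Nat.dvd_iff_prime_pow_dvd_dvd]
  intro p j hp hj
  rcases Nat.eq_zero_or_pos j with rfl | hj0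
  · simp
  have hpm : p ∣ m := hp.dvd_of_dvd_pow ((dvd_pow_self p hj0.ne').trans hj)
  have hodd : Odd p := hm.of_dvd_nat hpm
  obtain ⟨k, n, hpn, rfl⟩ := Nat.exists_eq_pow_mul_and_not_dvd hr.ne' p hp.ne_one
  have hjk : p ^ j ∣ p ^ (3 * k) := by
    have h : p ^ j ∣ p ^ (3 * k) * n ^ 3 := by
      refine hj.trans ((pow_dvd_pow_of_dvd hmr 3).trans (dvd_of_eq ?_))
      ring
    exact (((Nat.Prime.coprime_iff_not_dvd hp).2 hpn).pow j 3).dvd_of_dvd_mul_right h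
  refine hjk.trans ?_
  rw [← Int.natCast_dvd, Int.natCast_pow]
  exact pow_dvd_moebiusChooseSum hp hodd hpn k

theorem moebius_cast_zmod_two (n : ℕ) [Decidable (Squarefree n)] :
    ((ArithmeticFunction.moebius n : ℤ) : ZMod 2) = if Squarefree n then 1 else 0 := by
  split_ifs with h
  · have := ArithmeticFunction.moebius_ne_zero_iff_squarefree.2 h
    rcases ArithmeticFunction.moebius_ne_zero_iff_eq_or.1 this with h | h <;> rw [h] <;> decide
  · rw [ArithmeticFunction.moebius_eq_zero_of_not_squarefree h, Int.cast_zero]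

/-- Modulo 2, μ(m/d) is the indicator of m/d squarefree and the cofactor of the binomial difference
is that of d well-spaced, so t counts the set. -/
theorem exists_moebiusChooseSum_eq {m : ℕ} (hm : Odd m) (k : ℕ) :
    ∃ t : ℤ, moebiusChooseSum (2 ^ (k + 1) * m) = 2 ^ (3 * k + 2) * t ∧
      (Even t ↔
        Even (Set.ncard {w : ℕ | w ∈ oddWellSpaced ∧ w ∣ m ∧ Squarefree (m / w)})) := by
  classical
  have h2m : ¬ 2 ∣ m := by rw [← even_iff_two_dvd, Nat.not_even_iff_odd]; exact hm
  have hdodd : ∀ d ∈ m.divisors, Odd d := fun d hd => hm.of_dvd_nat (Nat.dvd_of_mem_divisors hd)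
  choose! c hc hceq using fun d (hd : d ∈ m.divisors) => exists_choose_sub_choose_eq (hdodd d hd) k
  have hc2 : ∀ d ∈ m.divisors, (c d : ZMod 2) = if WellSpaced d then 1 else 0 := by
    intro d hd
    have h : Odd (c d) ↔ WellSpaced d := by
      rw [hc d hd, odd_choose_three_mul_pred_iff
        (Nat.mul_pos (pow_pos two_pos k) (Nat.pos_of_mem_divisors hd)), wellSpaced_two_pow_mul]
    split_ifs with hw
    · exact (ZMod.intCast_eq_one_iff_odd).2 (h.2 hw)
    · exact (ZMod.intCast_eq_zero_iff_even).2 (Int.not_odd_iff_even.1 fun ho => hw (h.1 ho))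
  refine ⟨∑ d ∈ m.divisors, ArithmeticFunction.moebius (m / d) * c d, ?_, ?_⟩
  · rw [moebiusChooseSum, sum_divisors_moebius_prime_pow_mul Nat.prime_two h2m k
      (fun d => ((3 * d - 1).choose (d - 1) : ℤ)), Finset.mul_sum]
    refine Finset.sum_congr rfl fun d hd => ?_
    rw [hceq d hd]; ring
  · have hset : {w : ℕ | w ∈ oddWellSpaced ∧ w ∣ m ∧ Squarefree (m / w)}
        = ({d ∈ m.divisors | Squarefree (m / d) ∧ WellSpaced d} : Finset ℕ) := by
      ext w
      simp only [oddWellSpaced, Set.mem_ofPred_eq, Finset.coe_filter, Nat.mem_divisors]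
      constructor
      · rintro ⟨⟨_, h1⟩, h2, h3⟩
        exact ⟨⟨h2, hm.pos.ne'⟩, h3, h1⟩
      · rintro ⟨⟨h2, _⟩, h3, h1⟩
        exact ⟨⟨hm.of_dvd_nat h2, h1⟩, h2, h3⟩
    rw [hset, Set.ncard_coe_finset, ← ZMod.intCast_eq_zero_iff_even,
      ← ZMod.natCast_eq_zero_iff_even, Finset.natCast_card_filter]
    push_cast
    refine Eq.congr_left (Finset.sum_congr rfl fun d hd => ?_)
    rw [moebius_cast_zmod_two, hc2 d hd, ite_and]
    split_ifs <;> simp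

theorem mainTheorem1 (r : ℕ) (hr : 0 < r) :
    IsInteger (2 * bpsN r / (r : ℚ)) ∧
    (IsInteger (bpsN r / (r : ℚ)) ↔
      (Odd r ∨
        ∃ k r₁ : ℕ, 0 < k ∧ Odd r₁ ∧ r = 2 ^ k * r₁ ∧
          Even (Set.ncard {w : ℕ | w ∈ oddWellSpaced ∧ w ∣ r₁ ∧ Squarefree (r₁ / w)}))) := by
  have hr3 : ((r : ℤ) ^ 3) ≠ 0 := by positivity
  have e1 : 2 * bpsN r / (r : ℚ) = ((2 * moebiusChooseSum r : ℤ) : ℚ) / (((r : ℤ) ^ 3 : ℤ) : ℚ) := by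
    rw [bpsN_eq]; push_cast; field_simp
  have e2 : bpsN r / (r : ℚ) = (moebiusChooseSum r : ℚ) / (((r : ℤ) ^ 3 : ℤ) : ℚ) := by
    rw [bpsN_eq]; push_cast; field_simp
  rw [e1, e2, isInteger_div_iff hr3, isInteger_div_iff hr3]
  rcases Nat.even_or_odd r with heven | hodd
  · obtain ⟨k, m, h2m, hrm⟩ := Nat.exists_eq_pow_mul_and_not_dvd hr.ne' 2 (by decide)
    have hm : Odd m := by rwa [← Nat.not_even_iff_odd, even_iff_two_dvd]
    obtain ⟨k, rfl⟩ : ∃ l, k = l + 1 := by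
      refine Nat.exists_eq_succ_of_ne_zero ?_
      rintro rfl
      rw [pow_zero, one_mul] at hrm
      exact h2m (hrm ▸ even_iff_two_dvd.1 heven)
    obtain ⟨t, ht, hpar⟩ := exists_moebiusChooseSum_eq hm k
    rw [← hrm] at ht
    have hm3 : (m : ℤ) ^ 3 ∣ moebiusChooseSum r :=
      odd_cube_dvd_moebiusChooseSum hm hr ⟨2 ^ (k + 1), by rw [hrm, mul_comm]⟩
    have hcop : IsCoprime ((2 : ℤ) ^ (3 * k + 3)) ((m : ℤ) ^ 3) :=
      IsCoprime.pow (Int.isCoprime_two_left.2 ((Int.odd_coe_nat m).2 hm))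
    have hcube : (r : ℤ) ^ 3 = 2 ^ (3 * k + 3) * (m : ℤ) ^ 3 := by
      rw [hrm]; push_cast; ring
    -- The 2-part of r³ is 2^(3k+3) against 2^(3k+2)·t in the sum, so the parity of t decides.
    have hiff : (r : ℤ) ^ 3 ∣ moebiusChooseSum r ↔ Even t := by
      have h2 : (2 : ℤ) ^ (3 * k + 3) ∣ moebiusChooseSum r ↔ Even t := by
        rw [ht, pow_succ (2 : ℤ) (3 * k + 2), even_iff_two_dvd]
        exact mul_dvd_mul_iff_left (by positivity)
      rw [← h2, hcube]
      exact ⟨fun h => (dvd_mul_right _ _).trans h, fun h => hcop.mul_dvd h hm3⟩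
    refine ⟨?_, ?_⟩
    · rw [hcube]
      refine hcop.mul_dvd ⟨t, ?_⟩ (hm3.mul_left 2)
      rw [ht]; ring
    · rw [hiff, hpar]
      constructor
      · exact fun h => Or.inr ⟨k + 1, m, k.succ_pos, hm, hrm, h⟩
      · rintro (h | ⟨l, n, hl, hn, hrn, h⟩)
        · exact absurd heven (Nat.not_even_iff_odd.2 h)
        -- The odd part of `r` is unique, so any witness gives the same set.
        · have hmn : m = n := by
            have hc1 : Nat.Coprime m (2 ^ l) := (Nat.coprime_two_right.2 hm).pow_right l
            have hc2 : Nat.Coprime n (2 ^ (k + 1)) := (Nat.coprime_two_right.2 hn).pow_right _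
            have heq : 2 ^ (k + 1) * m = 2 ^ l * n := hrm.symm.trans hrn
            exact Nat.dvd_antisymm
              (hc1.dvd_of_dvd_mul_left (heq ▸ dvd_mul_left m _))
              (hc2.dvd_of_dvd_mul_left (heq ▸ dvd_mul_left n _))
          rwa [hmn]
  · have h := odd_cube_dvd_moebiusChooseSum hodd hr dvd_rfl
    exact ⟨h.mul_left 2, iff_of_true h (Or.inl hodd)⟩
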